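/- Let $R$ be a (not necessarily commutative) ring that is hereditary, i.e. both left and right hereditary, and let $\mathrm{fp\text{-}mod}\,R$ be the category of finitely presented right $R$-modules. Call a full subcategory $\mathcal{E}$ of $\mathrm{fp\text{-}mod}\,R$ \emph{well-placed} if it is an exact abelian subcategory (that is, $\mathcal{E}$ is an abelian category and the inclusion $\mathcal{E}\to\mathrm{fp\text{-}mod}\,R$ is exact) and it is closed under extensions in $\mathrm{fp\text{-}mod}\,R$. Let $\mathcal{E}$ be a well-placed subcategory of $\mathrm{fp\text{-}mod}\,R$ such that every nonzero module in $\mathcal{E}$ has homological (projective) dimension exactly $1$. Then $\mathcal{E}$ is a finite length category, that is, an abelian category in which every object has a finite composition series with simple factors (subobjects, simplicity and exactness being taken in $\mathcal{E}$). -/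

import Mathlib

open CategoryTheory CategoryTheory.Limits

universe u

/-- A (not necessarily commutative) ring is hereditary if it is left and right hereditary:
every left ideal is a projective left module and every right ideal is a projective right
module. Right modules over `R` are modules over `Rᵐᵒᵖ`. -/
structure IsHereditaryRing (R : Type u) [Ring R] : Prop where
  left : ∀ I : Submodule R R, Module.Projective R I
  right : ∀ I : Submodule Rᵐᵒᵖ R, Module.Projective Rᵐᵒᵖ I

/-- The property of being a finitely presented right `R`-module. -/
def isFinPres (R : Type u) [Ring R] : ObjectProperty (ModuleCat.{u} Rᵐᵒᵖ) :=
  fun M => Module.FinitePresentation Rᵐᵒᵖ M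

/-- The category `fp-mod R` of finitely presented right `R`-modules,
a full subcategory of the category of all right `R`-modules. -/
abbrev FPMod (R : Type u) [Ring R] := (isFinPres R).FullSubcategory

/-- A preadditive category is abelian: it has finite products, kernels and cokernels, every
monomorphism is a kernel and every epimorphism is a cokernel. (The propositional version of
Mathlib's `Abelian`, with respect to the given preadditive structure.) -/
structure IsAbelianCategory (C : Type*) [Category C] [Preadditive C] : Prop where
  hasFiniteProducts : HasFiniteProducts C
  hasKernels : HasKernels C
  hasCokernels : HasCokernels C
  normalMono : IsNormalMonoCategory C
  normalEpi : IsNormalEpiCategory C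

/-- Objects of finite length: those with a finite composition series, that is, the objects
obtained from zero objects by finitely many successive extensions by simple objects. -/
inductive HasFiniteLength {C : Type*} [Category C] [HasZeroMorphisms C] : C → Prop
  | of_isZero {X : C} (hX : IsZero X) : HasFiniteLength X
  | of_shortExact {S : ShortComplex C} (hS : S.ShortExact)
      (h₁ : HasFiniteLength S.X₁) (h₃ : Simple S.X₃) : HasFiniteLength S.X₂

/-- A finite length category: an abelian category all of whose objects have finite length. -/
structure IsFiniteLengthCategory (C : Type*) [Category C] [Preadditive C] : Prop where
  isAbelian : IsAbelianCategory C
  hasFiniteLength : ∀ X : C, HasFiniteLength X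

/-- A full subcategory `E` of `fp-mod R` is well-placed if it is an exact abelian subcategory
(it is an abelian category and its inclusion functor into `fp-mod R` is exact) and it is closed
under extensions: if `0 → L → M → N → 0` is a short exact sequence of finitely presented
modules with `L` and `N` in `E`, then `M` is in `E`. -/
structure IsWellPlaced {R : Type u} [Ring R] (E : ObjectProperty (FPMod R)) : Prop where
  isAbelian : IsAbelianCategory E.FullSubcategory
  preservesFiniteLimits : PreservesFiniteLimits E.ι
  preservesFiniteColimits : PreservesFiniteColimits E.ι
  extension_closed : ∀ (L M N : FPMod R)
    (f : L.obj →ₗ[Rᵐᵒᵖ] M.obj) (g : M.obj →ₗ[Rᵐᵒᵖ] N.obj),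
    Function.Injective f → Function.Exact f g → Function.Surjective g → E L → E N → E M

/-! Every `X` in `E` is bound, i.e. has no nonzero form `X → R`: the image of a form is a projective
right ideal, so it splits off `X`. The resulting idempotent splits in the abelian category `E`,
giving a projective object of `E`, which is zero because nonzero objects have dimension 1.
Subobjects of `X` thus give finitely generated bound submodules, and both chain conditions must be
proved for these.

Write `X = F/K` with `F` free of finite rank and `K` finitely generated, and pull a chain back to
submodules `Q i` of `F` containing `K`. These are projective, and boundness makes a form on `Q i`
determined by its restriction to `K`. For an increasing chain the same holds for the union, so only
the finitely many dual-basis coordinates that occur on `K` are nonzero and the union is finitely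
generated. For a decreasing chain, dualize: the duals of the `Q i` form an increasing chain of left
submodules of the dual of `K`. Left heredity makes their union projective, a similar argument makes
it finitely generated, and the chain stops; duality then recovers the `Q i`. -/

/-! ### Projectivity, dual bases and finite generation -/

/-- If every submodule of `A` is projective, then so is every module that embeds in a finite
power of `A`. -/
theorem projective_of_injective_to_pi {S : Type*} [Ring S] {A : Type*} [AddCommGroup A]
    [Module S A] (hA : ∀ I : Submodule S A, Module.Projective S I) (n : ℕ) :
    ∀ {N : Type u} [AddCommGroup N] [Module S N] (f : N →ₗ[S] (Fin n → A)),
      Function.Injective f → Module.Projective S N := by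
  induction n with
  | zero =>
    intro N _ _ f hf
    have : Subsingleton N := hf.subsingleton
    infer_instance
  | succ n ih =>
    intro N _ _ f hf
    -- The range of the first coordinate is projective, hence splits off; the kernel embeds in the
    -- remaining `n` coordinates.
    let g : N →ₗ[S] A := LinearMap.proj 0 ∘ₗ f
    have hg : ∀ x, g x = f x 0 := fun x => rfl
    have : Module.Projective S (LinearMap.range g) := hA _
    obtain ⟨s, hs⟩ := g.rangeRestrict.exists_rightInverse_of_surjective g.range_rangeRestrict
    have hs' : ∀ r, g (s r) = r := fun r => congrArg Subtype.val (LinearMap.congr_fun hs r)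
    have : Module.Projective S (LinearMap.ker g) := by
      refine ih (LinearMap.funLeft S A Fin.succ ∘ₗ f ∘ₗ (LinearMap.ker g).subtype) ?_
      intro x y hxy
      apply Subtype.ext
      apply hf
      funext i
      refine Fin.cases ?_ (fun j => congrFun hxy j) i
      rw [← hg, ← hg, x.2, y.2]
    refine Module.Projective.of_split (M := LinearMap.ker g × LinearMap.range g)
      (LinearMap.prod (LinearMap.codRestrict _ (LinearMap.id - s ∘ₗ g.rangeRestrict) ?_)
        g.rangeRestrict)
      (LinearMap.coprod (LinearMap.ker g).subtype s) ?_
    · intro x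
      simp [hs']
    · ext x
      simp

/-- A projective module `N` is finitely generated if it has a finitely generated submodule `K`
such that no nonzero linear form on `N` vanishes on `K`. -/
theorem finite_of_forms_eq_zero {S : Type*} [Ring S] {N : Type*} [AddCommGroup N] [Module S N]
    [Module.Projective S N] (K : Submodule S N) (hK : K.FG)
    (h : ∀ φ : N →ₗ[S] S, (∀ x ∈ K, φ x = 0) → φ = 0) : Module.Finite S N := by
  classical
  obtain ⟨s, hs⟩ := (Module.projective_def (R := S) (P := N)).1 inferInstance
  obtain ⟨t, rfl⟩ := hK
  -- Only coordinates in `F` occur on generators of `K`; any other coordinate form vanishes on `K`,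
  -- hence on `N`.
  let F : Finset N := t.biUnion fun x => (s x).support
  have hF : ∀ i ∉ F, ∀ x, s x i = 0 := by
    intro i hi x
    have hz : Finsupp.lapply i ∘ₗ s = 0 := by
      apply h
      intro y hy
      induction hy using Submodule.span_induction with
      | mem y hy =>
        by_contra hne
        exact hi (Finset.mem_biUnion.2 ⟨y, hy, Finsupp.mem_support_iff.2 hne⟩)
      | zero => simp
      | add a b _ _ ha hb => rw [map_add, ha, hb, add_zero]
      | smul r a _ ha => rw [map_smul, ha, smul_zero]
    exact LinearMap.congr_fun hz x
  refine ⟨⟨F, eq_top_iff.2 fun x _ => ?_⟩⟩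
  rw [← hs x, Finsupp.linearCombination_apply]
  refine Submodule.sum_mem _ fun i hi => Submodule.smul_mem _ _ (Submodule.subset_span ?_)
  by_contra hne
  exact (Finsupp.mem_support_iff.1 hi) (hF i hne x)

/-- A ring as a right module over itself, in the two forms available in Mathlib. -/
def rightRegularEquiv (R : Type*) [Ring R] : R ≃ₗ[Rᵐᵒᵖ] Rᵐᵒᵖ where
  toFun := MulOpposite.op
  invFun := MulOpposite.unop
  map_add' _ _ := rfl
  map_smul' _ _ := rfl
  left_inv _ := rfl
  right_inv _ := rfl

/-- If all right ideals are projective, so are all submodules of finite free right modules. -/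
theorem projective_submodule_pi {R : Type u} [Ring R]
    (hR : ∀ I : Submodule Rᵐᵒᵖ R, Module.Projective Rᵐᵒᵖ I) (n : ℕ)
    (N : Submodule Rᵐᵒᵖ (Fin n → Rᵐᵒᵖ)) : Module.Projective Rᵐᵒᵖ N := by
  let e : (Fin n → Rᵐᵒᵖ) ≃ₗ[Rᵐᵒᵖ] (Fin n → R) :=
    LinearEquiv.piCongrRight fun _ => (rightRegularEquiv R).symm
  exact projective_of_injective_to_pi hR n (e.toLinearMap ∘ₗ N.subtype)
    (e.injective.comp N.subtype_injective)

/-- The dual basis of a finitely generated projective right module. -/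
theorem exists_dual_basis {R : Type*} [Ring R] (Q : Type*) [AddCommGroup Q] [Module Rᵐᵒᵖ Q]
    [Module.Finite Rᵐᵒᵖ Q] [Module.Projective Rᵐᵒᵖ Q] :
    ∃ (n : ℕ) (x : Fin n → Q) (f : Fin n → (Q →ₗ[Rᵐᵒᵖ] R)),
      ∀ q, ∑ k, MulOpposite.op (f k q) • x k = q := by
  obtain ⟨n, p, hp⟩ := Module.Finite.exists_fin' Rᵐᵒᵖ Q
  obtain ⟨s, hs⟩ := p.exists_rightInverse_of_surjective (LinearMap.range_eq_top.2 hp)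
  refine ⟨n, fun k => p (Pi.single k 1),
    fun k => (rightRegularEquiv R).symm.toLinearMap ∘ₗ LinearMap.proj k ∘ₗ s, fun q => ?_⟩
  have h : p (s q) = q := LinearMap.congr_fun hs q
  conv_rhs => rw [← h, pi_eq_sum_univ' (s q), map_sum]
  refine Finset.sum_congr rfl fun k _ => ?_
  rw [map_smul]
  congr 2

/-- A finitely generated union of an increasing sequence of submodules is one of them. -/
theorem exists_eq_iSup_of_fg {S M : Type*} [Ring S] [AddCommGroup M] [Module S M]
    {N : ℕ → Submodule S M} (hN : Monotone N) (h : (⨆ i, N i).FG) : ∃ i, ⨆ j, N j = N i := by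
  obtain ⟨t, ht⟩ := h
  have ht' : ∀ x ∈ t, ∃ i, x ∈ N i := fun x hx =>
    (Submodule.mem_iSup_of_directed N hN.directed_le).1 (ht ▸ Submodule.subset_span hx)
  choose! i hi using ht'
  refine ⟨t.sup i, le_antisymm ?_ (le_iSup N _)⟩
  rw [← ht, Submodule.span_le]
  exact fun x hx => hN (Finset.le_sup hx) (hi x hx)

/-! ### Bound modules and the ascending chain condition -/

/-- A right module is bound if it has no nonzero linear form. -/
def IsBoundModule (R M : Type*) [Ring R] [AddCommGroup M] [Module Rᵐᵒᵖ M] : Prop :=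
  ∀ φ : M →ₗ[Rᵐᵒᵖ] R, φ = 0

/-- A linear form on the preimage of a bound submodule vanishes if it does so on the kernel. -/
theorem IsBoundModule.form_eq_zero {R F M : Type*} [Ring R] [AddCommGroup M] [Module Rᵐᵒᵖ M]
    [AddCommGroup F] [Module Rᵐᵒᵖ F] {p : F →ₗ[Rᵐᵒᵖ] M} (hp : Function.Surjective p)
    {N : Submodule Rᵐᵒᵖ M} (hN : IsBoundModule R N) (φ : N.comap p →ₗ[Rᵐᵒᵖ] R)
    (h : ∀ x : N.comap p, p x = 0 → φ x = 0) : φ = 0 := by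
  let q : N.comap p →ₗ[Rᵐᵒᵖ] N := p.restrict fun x hx => hx
  have hq : Function.Surjective q := fun y => by
    obtain ⟨x, hx⟩ := hp y
    exact ⟨⟨x, by simp [hx]⟩, Subtype.ext hx⟩
  have hle : LinearMap.ker q ≤ LinearMap.ker φ := fun x hx =>
    h x (congrArg Subtype.val (show q x = 0 from hx))
  let ψ : N →ₗ[Rᵐᵒᵖ] R :=
    (LinearMap.ker q).liftQ φ hle ∘ₗ (q.quotKerEquivOfSurjective hq).symm.toLinearMap
  ext x
  have hx : ψ (q x) = φ x := by
    have : (q.quotKerEquivOfSurjective hq).symm (q x) = Submodule.Quotient.mk x := by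
      rw [LinearEquiv.symm_apply_eq]; rfl
    simp [ψ, this]
  rw [← hx, hN ψ]; rfl

/-- Over a ring whose right ideals are projective, an increasing union of bound submodules of a
finitely presented right module is finitely generated. -/
theorem iSup_fg_of_isBoundModule {R : Type u} [Ring R]
    (hR : ∀ I : Submodule Rᵐᵒᵖ R, Module.Projective Rᵐᵒᵖ I) (M : Type u) [AddCommGroup M]
    [Module Rᵐᵒᵖ M] [Module.FinitePresentation Rᵐᵒᵖ M] (N : ℕ → Submodule Rᵐᵒᵖ M)
    (hN : Monotone N) (hb : ∀ i, IsBoundModule R (N i)) : (⨆ i, N i).FG := by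
  obtain ⟨n, p, hp⟩ := Module.Finite.exists_fin' Rᵐᵒᵖ M
  have hker : (LinearMap.ker p).FG := Module.FinitePresentation.fg_ker p hp
  let U := ⨆ i, N i
  have hmem : ∀ {x}, x ∈ U ↔ ∃ i, x ∈ N i := Submodule.mem_iSup_of_directed N hN.directed_le
  have hproj : Module.Projective Rᵐᵒᵖ (U.comap p) :=
    projective_submodule_pi hR n _
  have hfin : Module.Finite Rᵐᵒᵖ (U.comap p) := by
    refine finite_of_forms_eq_zero ((LinearMap.ker p).comap (U.comap p).subtype) ?_ ?_
    · rw [← Submodule.fg_top] at hker ⊢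
      have hle : LinearMap.ker p ≤ U.comap p := fun x hx => by
        rw [Submodule.mem_comap, LinearMap.mem_ker.1 hx]; exact zero_mem _
      have := hker.map (Submodule.comapSubtypeEquivOfLe hle).symm.toLinearMap
      rwa [Submodule.map_top, LinearEquiv.range] at this
    · intro φ hφ
      ext x
      -- The union need not be known to be bound: `φ` is killed on the preimage of each `N i`
      -- separately.
      obtain ⟨i, hi⟩ := hmem.1 x.2
      have hz := (hb i).form_eq_zero hp
        ((rightRegularEquiv R).symm.toLinearMap ∘ₗ φ ∘ₗ
          Submodule.inclusion (Submodule.comap_mono (le_iSup N i))) (fun y hy => by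
            simp only [LinearMap.comp_apply]
            rw [hφ _ hy, map_zero])
      exact congrArg MulOpposite.op (LinearMap.congr_fun hz ⟨x, hi⟩)
  have hfg : (U.comap p).FG := Module.Finite.iff_fg.1 hfin
  have := hfg.map p
  rwa [Submodule.map_comap_eq_of_surjective hp] at this

/-! ### Duality and the descending chain condition -/

/-- The dual of a finitely generated projective right module is finitely generated. -/
theorem finite_dual {R : Type*} [Ring R] (Q : Type*) [AddCommGroup Q] [Module Rᵐᵒᵖ Q]
    [Module.Finite Rᵐᵒᵖ Q] [Module.Projective Rᵐᵒᵖ Q] : Module.Finite R (Q →ₗ[Rᵐᵒᵖ] R) := by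
  classical
  obtain ⟨n, x, f, hxf⟩ := exists_dual_basis (R := R) Q
  refine ⟨⟨Finset.univ.image f, eq_top_iff.2 fun φ _ => ?_⟩⟩
  have : φ = ∑ k, φ (x k) • f k := by
    ext q
    conv_lhs => rw [← hxf q]
    simp
  rw [this]
  exact Submodule.sum_mem _ fun k _ => Submodule.smul_mem _ _ (Submodule.subset_span (by simp))

/-- Restriction of linear forms along a linear map of right modules. -/
def dualRestrict {R Q P : Type*} [Ring R] [AddCommGroup Q] [Module Rᵐᵒᵖ Q] [AddCommGroup P]
    [Module Rᵐᵒᵖ P] (i : P →ₗ[Rᵐᵒᵖ] Q) : (Q →ₗ[Rᵐᵒᵖ] R) →ₗ[R] (P →ₗ[Rᵐᵒᵖ] R) where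
  toFun φ := φ ∘ₗ i
  map_add' _ _ := rfl
  map_smul' _ _ := rfl

/-- Evaluation at a finite family of generators embeds the dual of a right module into a free
left module. -/
theorem exists_dual_injective {R : Type*} [Ring R] (K : Type*) [AddCommGroup K] [Module Rᵐᵒᵖ K]
    [Module.Finite Rᵐᵒᵖ K] :
    ∃ (n : ℕ) (ε : (K →ₗ[Rᵐᵒᵖ] R) →ₗ[R] (Fin n → R)), Function.Injective ε := by
  obtain ⟨n, x, hx⟩ := Module.Finite.exists_fin (R := Rᵐᵒᵖ) (M := K)
  refine ⟨n, { toFun := fun φ k => φ (x k), map_add' := fun _ _ => rfl,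
               map_smul' := fun _ _ => rfl }, fun φ ψ h => ?_⟩
  exact LinearMap.ext_on_range hx fun k => congrFun h k

/-- A linear form on the dual of a finitely generated projective right module is an evaluation. -/
theorem exists_eval_of_dual_form {R : Type*} [Ring R] (Q : Type*) [AddCommGroup Q]
    [Module Rᵐᵒᵖ Q] [Module.Finite Rᵐᵒᵖ Q] [Module.Projective Rᵐᵒᵖ Q]
    (ψ : (Q →ₗ[Rᵐᵒᵖ] R) →ₗ[R] R) : ∃ q : Q, ∀ φ, ψ φ = φ q := by
  obtain ⟨n, x, f, hxf⟩ := exists_dual_basis (R := R) Q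
  refine ⟨∑ k, MulOpposite.op (ψ (f k)) • x k, fun φ => ?_⟩
  have : φ = ∑ k, φ (x k) • f k := by
    ext q
    conv_lhs => rw [← hxf q]
    simp
  conv_lhs => rw [this]
  simp

/-- Linear forms separate the elements of a finitely generated projective right module. -/
theorem eq_of_forall_form_eq {R Q : Type*} [Ring R] [AddCommGroup Q]
    [Module Rᵐᵒᵖ Q] [Module.Finite Rᵐᵒᵖ Q] [Module.Projective Rᵐᵒᵖ Q] {x y : Q}
    (h : ∀ φ : Q →ₗ[Rᵐᵒᵖ] R, φ x = φ y) : x = y := by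
  obtain ⟨n, b, f, hbf⟩ := exists_dual_basis (R := R) Q
  rw [← hbf x, ← hbf y]
  simp [h]

/-- Over a hereditary ring, a decreasing sequence of finitely generated projective submodules of
a finitely generated projective right module is stationary, if all its members contain a finitely
generated submodule `K` and their linear forms are determined by their restrictions to `K`. -/
theorem exists_le_succ_of_antitone {R : Type u} [Ring R]
    (hR : ∀ I : Submodule R R, Module.Projective R I) (F : Type u) [AddCommGroup F]
    [Module Rᵐᵒᵖ F] [Module.Finite Rᵐᵒᵖ F] [Module.Projective Rᵐᵒᵖ F]
    (K : Submodule Rᵐᵒᵖ F) [Module.Finite Rᵐᵒᵖ K]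
    (Q : ℕ → Submodule Rᵐᵒᵖ F) (hQ : Antitone Q) (hKQ : ∀ i, K ≤ Q i)
    (hfin : ∀ i, Module.Finite Rᵐᵒᵖ (Q i)) (hproj : ∀ i, Module.Projective Rᵐᵒᵖ (Q i))
    (hform : ∀ i (φ : Q i →ₗ[Rᵐᵒᵖ] R), (∀ x : Q i, (x : F) ∈ K → φ x = 0) → φ = 0) :
    ∃ i, Q i ≤ Q (i + 1) := by
  let ρ : ∀ i, (Q i →ₗ[Rᵐᵒᵖ] R) →ₗ[R] (K →ₗ[Rᵐᵒᵖ] R) :=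
    fun i => dualRestrict (Submodule.inclusion (hKQ i))
  let L : ℕ → Submodule R (K →ₗ[Rᵐᵒᵖ] R) := fun i => LinearMap.range (ρ i)
  have hL : Monotone L := by
    rintro i j hij _ ⟨φ, rfl⟩
    exact ⟨dualRestrict (Submodule.inclusion (hQ hij)) φ, rfl⟩
  let Λ : Submodule R (K →ₗ[Rᵐᵒᵖ] R) := ⨆ i, L i
  have hmem : ∀ {x}, x ∈ Λ ↔ ∃ i, x ∈ L i :=
    Submodule.mem_iSup_of_directed L hL.directed_le
  let σ : (F →ₗ[Rᵐᵒᵖ] R) →ₗ[R] Λ :=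
    (dualRestrict K.subtype).codRestrict _ fun φ =>
      hmem.2 ⟨0, dualRestrict (Q 0).subtype φ, rfl⟩
  have hLproj : Module.Projective R Λ := by
    obtain ⟨n, ε, hε⟩ := exists_dual_injective (R := R) K
    have hinj : Function.Injective (ε ∘ₗ Λ.subtype) := hε.comp Λ.subtype_injective
    exact projective_of_injective_to_pi hR n (N := Λ) (ε ∘ₗ Λ.subtype) hinj
  have hFdual : Module.Finite R (F →ₗ[Rᵐᵒᵖ] R) := finite_dual F
  have hLfin : Module.Finite R Λ := by
    refine finite_of_forms_eq_zero (S := R) (N := Λ) (LinearMap.range σ) ?_ fun φ hφ => ?_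
    · rw [← Submodule.map_top]
      exact hFdual.fg_top.map σ
    · ext ⟨x, hx⟩
      obtain ⟨i, g, rfl⟩ := hmem.1 hx
      let τ : (Q i →ₗ[Rᵐᵒᵖ] R) →ₗ[R] Λ :=
        (ρ i).codRestrict _ fun ψ => hmem.2 ⟨i, ψ, rfl⟩
      -- By reflexivity `φ` acts on the dual of `Q i` as evaluation at some `q`; all forms on `F`
      -- vanish at `q`, so `q = 0`.
      obtain ⟨q, hq⟩ := exists_eval_of_dual_form (Q i) (φ ∘ₗ τ)
      have hq0 : (q : F) = 0 := eq_of_forall_form_eq (R := R) fun h => by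
        rw [h.map_zero]
        have := hq (dualRestrict (Q i).subtype h)
        rw [show h q = dualRestrict (Q i).subtype h q from rfl, ← this]
        exact hφ _ ⟨h, rfl⟩
      have := hq g
      rw [Subtype.ext (a2 := (0 : Q i)) hq0, map_zero] at this
      exact this
  obtain ⟨i, hi⟩ := exists_eq_iSup_of_fg hL (Module.Finite.iff_fg.1 hLfin)
  refine ⟨i, fun x hx => ?_⟩
  obtain ⟨n, b, f, hbf⟩ := exists_dual_basis (R := R) (Q (i + 1))
  -- Since the duals agree inside the dual of `K`, the dual basis of `Q (i + 1)` extends to forms on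
  -- `Q i`. The dual-basis formula then holds on `K`, hence on all of `Q i`, and its values lie in
  -- `Q (i + 1)`.
  have hext : ∀ k, ∃ g : Q i →ₗ[Rᵐᵒᵖ] R, ρ i g = ρ (i + 1) (f k) := fun k => by
    have : ρ (i + 1) (f k) ∈ L i := hi ▸ hmem.2 ⟨i + 1, f k, rfl⟩
    exact this
  choose g hg using hext
  have hgf : ∀ k c (hc : c ∈ K), g k ⟨c, hKQ i hc⟩ = f k ⟨c, hKQ (i + 1) hc⟩ := fun k c hc =>
    LinearMap.congr_fun (hg k) ⟨c, hc⟩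
  have hxy : x = ((∑ k, MulOpposite.op (g k ⟨x, hx⟩) • b k : Q (i + 1)) : F) := by
    refine eq_of_forall_form_eq (R := R) fun h => ?_
    have hz := hform i (h ∘ₗ (Q i).subtype - ∑ k, h (b k) • g k) fun c hc => by
      have h1 : ((∑ k, MulOpposite.op (f k ⟨c, hKQ (i + 1) hc⟩) • b k : Q (i + 1)) : F) = c :=
        congrArg Subtype.val (hbf ⟨c, hKQ (i + 1) hc⟩)
      have h2 := congrArg h h1
      simp only [AddSubmonoidClass.coe_finsetSum, SetLike.val_smul, map_sum, map_smul,
        MulOpposite.smul_eq_mul_unop, MulOpposite.unop_op] at h2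
      simp [← h2, hgf _ _ hc]
    have := LinearMap.congr_fun hz ⟨x, hx⟩
    simpa [sub_eq_zero] using this
  rw [hxy]
  exact Subtype.property _

/-- Over a hereditary ring, a decreasing sequence of finitely generated bound submodules of a
finitely presented right module is stationary. -/
theorem exists_le_succ_of_isBoundModule {R : Type u} [Ring R] (hR : IsHereditaryRing R)
    (M : Type u) [AddCommGroup M] [Module Rᵐᵒᵖ M] [Module.FinitePresentation Rᵐᵒᵖ M]
    (N : ℕ → Submodule Rᵐᵒᵖ M) (hN : Antitone N)
    (hfg : ∀ i, (N i).FG) (hb : ∀ i, IsBoundModule R (N i)) : ∃ i, N i ≤ N (i + 1) := by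
  obtain ⟨n, p, hp⟩ := Module.Finite.exists_fin' Rᵐᵒᵖ M
  have hker : (LinearMap.ker p).FG := Module.FinitePresentation.fg_ker p hp
  have : Module.Finite Rᵐᵒᵖ (LinearMap.ker p) := Module.Finite.iff_fg.2 hker
  have hle : ∀ i, LinearMap.ker p ≤ (N i).comap p := fun i x hx => by
    rw [Submodule.mem_comap, LinearMap.mem_ker.1 hx]; exact zero_mem _
  obtain ⟨i, hi⟩ := exists_le_succ_of_antitone hR.left (Fin n → Rᵐᵒᵖ) (LinearMap.ker p)
    (fun i => (N i).comap p) (fun i j hij => Submodule.comap_mono (hN hij)) hle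
    (fun i => Module.Finite.iff_fg.2 (by
      refine Submodule.fg_of_fg_map_of_fg_inf_ker p ?_ ?_
      · rw [Submodule.map_comap_eq_of_surjective hp]; exact hfg i
      · rwa [inf_eq_right.2 (hle i)]))
    (fun i => projective_submodule_pi hR.right n _)
    (fun i φ hφ => (hb i).form_eq_zero hp φ hφ)
  refine ⟨i, fun x hx => ?_⟩
  obtain ⟨y, rfl⟩ := hp x
  exact hi hx

/-! ### Finite length from the two chain conditions -/

theorem HasFiniteLength.of_iso {C : Type*} [Category C] [HasZeroMorphisms C] {X Y : C}
    (e : X ≅ Y) (h : HasFiniteLength X) : HasFiniteLength Y := by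
  cases h with
  | of_isZero hX => exact .of_isZero (hX.of_iso e.symm)
  | @of_shortExact S hS h₁ h₃ =>
    let T : ShortComplex C := ShortComplex.mk (S.f ≫ e.hom) (e.inv ≫ S.g) (by simp)
    have hT : T.ShortExact := ShortComplex.shortExact_of_iso
      (ShortComplex.isoMk (S₁ := S) (S₂ := T) (Iso.refl _) e (Iso.refl _) (by simp [T])
        (by simp [T])) hS
    exact HasFiniteLength.of_shortExact hT h₁ h₃

/-- In an abelian category all of whose objects are Noetherian and Artinian, all objects have
finite length. -/
theorem hasFiniteLength_of_noetherian_of_artinian {C : Type*} [Category C] [Abelian C]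
    (hN : ∀ X : C, IsNoetherianObject X) (hA : ∀ X : C, IsArtinianObject X) (X : C) :
    HasFiniteLength X := by
  have := hN X
  obtain ⟨S, hS, hmax⟩ := (wellFounded_gt (α := Subobject X)).has_min
    {S : Subobject X | HasFiniteLength (S : C)} ⟨⊥, .of_isZero (by
      exact (isZero_zero C).of_iso Subobject.botCoeIsoZero)⟩
  by_cases hz : IsZero (cokernel S.arrow)
  · have : Epi S.arrow := Preadditive.epi_of_isZero_cokernel _ hz
    have : IsIso S.arrow := isIso_of_mono_of_epi _
    exact hS.of_iso (asIso S.arrow)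
  · exfalso
    have := hA (cokernel S.arrow)
    obtain ⟨T, hT⟩ := exists_simple_subobject hz
    -- `P` is the preimage in `X` of a simple `T ⊆ X/S`: an extension of `T` by `S`, contradicting
    -- maximality of `S`.
    let P := pullback (cokernel.π S.arrow) T.arrow
    let a : P ⟶ X := pullback.fst _ _
    let b : P ⟶ (T : C) := pullback.snd _ _
    have hab : a ≫ cokernel.π S.arrow = b ≫ T.arrow := pullback.condition
    let i : (S : C) ⟶ P := pullback.lift S.arrow 0 (by simp)
    have hia : i ≫ a = S.arrow := pullback.lift_fst _ _ _
    have hib : i ≫ b = 0 := pullback.lift_snd _ _ _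
    have : Mono i := mono_of_mono_fac hia
    have hker : IsLimit (KernelFork.ofι i hib) := by
      refine KernelFork.IsLimit.ofι' _ _ fun {A} k hk => ?_
      have hk' : (k ≫ a) ≫ cokernel.π S.arrow = 0 := by
        rw [Category.assoc, hab, reassoc_of% hk, zero_comp]
      refine ⟨Abelian.monoLift S.arrow (k ≫ a) hk', ?_⟩
      apply pullback.hom_ext
      · change (_ ≫ i) ≫ a = k ≫ a
        rw [Category.assoc, hia, Abelian.monoLift_comp]
      · change (_ ≫ i) ≫ b = k ≫ b
        rw [Category.assoc, hib, hk, comp_zero]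
    let E : ShortComplex C := ShortComplex.mk i b hib
    have hE : E.ShortExact :=
      { exact := ShortComplex.exact_of_f_is_kernel _ hker
        mono_f := ‹Mono i›
        epi_g := inferInstanceAs (Epi (pullback.snd (cokernel.π S.arrow) T.arrow)) }
    have hP : HasFiniteLength P := HasFiniteLength.of_shortExact hE hS hT
    have : Mono a := inferInstanceAs (Mono (pullback.fst (cokernel.π S.arrow) T.arrow))
    refine hmax (Subobject.mk a) (hP.of_iso (Subobject.underlyingIso a).symm)
      (lt_of_le_of_ne (Subobject.le_mk_of_comm i hia) fun h => ?_)
    have hle : Subobject.mk a ≤ S := h.ge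
    have ha : a ≫ cokernel.π S.arrow = 0 := by
      rw [← Subobject.ofMkLE_arrow hle, Category.assoc, cokernel.condition, comp_zero]
    have hb : b = 0 := by
      rw [hab] at ha
      exact (cancel_mono T.arrow).1 (by rw [ha, zero_comp])
    have hepi : Epi b := hE.epi_g
    rw [hb] at hepi
    exact Simple.not_isZero (T : C) (IsZero.of_epi_zero P (T : C))

/-! ### Well-placed subcategories -/

/-- The structure of an abelian category given by the propositional version. -/
@[reducible] noncomputable def IsAbelianCategory.abelian {C : Type*} [Category C] [Preadditive C]
    (h : IsAbelianCategory C) : Abelian C :=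
  { (inferInstance : Preadditive C) with
    has_finite_products := h.hasFiniteProducts
    has_kernels := h.hasKernels
    has_cokernels := h.hasCokernels
    normalMonoOfMono := h.normalMono.normalMonoOfMono
    normalEpiOfEpi := h.normalEpi.normalEpiOfEpi }

/-- The linear map underlying a morphism of a full subcategory of `fp-mod R`. -/
def linOf {R : Type u} [Ring R] {E : ObjectProperty (FPMod R)} {X Y : E.FullSubcategory}
    (f : X ⟶ Y) : X.obj.obj →ₗ[Rᵐᵒᵖ] Y.obj.obj := f.hom.hom.hom

/-- The morphism given by a linear map. -/
def homOf {R : Type u} [Ring R] {E : ObjectProperty (FPMod R)} {X Y : E.FullSubcategory}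
    (f : X.obj.obj →ₗ[Rᵐᵒᵖ] Y.obj.obj) : X ⟶ Y := ⟨⟨ModuleCat.ofHom f⟩⟩

/-- Monomorphisms of finitely presented modules are injective. -/
theorem FPMod.injective_of_mono {R : Type u} [Ring R] {X Y : FPMod R} (f : X ⟶ Y) [Mono f] :
    Function.Injective f.hom.hom := by
  refine (injective_iff_map_eq_zero f.hom.hom).2 fun x hx => ?_
  let A : FPMod R := ⟨ModuleCat.of Rᵐᵒᵖ Rᵐᵒᵖ, by
    change Module.FinitePresentation Rᵐᵒᵖ Rᵐᵒᵖ
    infer_instance⟩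
  let g : A ⟶ X := ⟨ModuleCat.ofHom (LinearMap.toSpanSingleton Rᵐᵒᵖ X.obj x)⟩
  let z : A ⟶ X := ⟨ModuleCat.ofHom 0⟩
  have hgz : g ≫ f = z ≫ f := by
    ext
    change f.hom.hom ((1 : Rᵐᵒᵖ) • x) = f.hom.hom 0
    rw [one_smul, hx, map_zero]
  have h : g = z := (cancel_mono f).1 hgz
  have h1 : g.hom.hom (1 : Rᵐᵒᵖ) = z.hom.hom (1 : Rᵐᵒᵖ) := by rw [h]
  change (1 : Rᵐᵒᵖ) • x = 0 at h1
  rwa [one_smul] at h1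

theorem IsWellPlaced.injective_of_mono {R : Type u} [Ring R] {E : ObjectProperty (FPMod R)}
    (hE : IsWellPlaced E) {X Y : E.FullSubcategory} (f : X ⟶ Y) [Mono f] :
    Function.Injective (linOf f) := by
  have := hE.preservesFiniteLimits
  have : Mono (E.ι.map f) := inferInstance
  exact FPMod.injective_of_mono (E.ι.map f)

/-- A well-placed subcategory whose nonzero modules have projective dimension one consists of
bound modules. -/
theorem IsWellPlaced.isBoundModule {R : Type u} [Ring R] (hR : IsHereditaryRing R)
    {E : ObjectProperty (FPMod R)} (hE : IsWellPlaced E)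
    (hdim : ∀ M : FPMod R, E M → Nontrivial M.obj → projectiveDimension M.obj = 1)
    (X : E.FullSubcategory) : IsBoundModule R X.obj.obj := by
  intro φ
  have : Module.Projective Rᵐᵒᵖ (LinearMap.range φ) := hR.right _
  obtain ⟨s, hs⟩ := φ.rangeRestrict.exists_rightInverse_of_surjective φ.range_rangeRestrict
  have hs' : ∀ r, φ.rangeRestrict (s r) = r := fun r => LinearMap.congr_fun hs r
  let := hE.isAbelian.abelian
  have hidem : IsIdempotentComplete E.FullSubcategory := inferInstance
  obtain ⟨P, i, p, hip, hpi⟩ := hidem.idempotents_split X (homOf (s ∘ₗ φ.rangeRestrict)) (by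
    ext x
    change s (φ.rangeRestrict (s (φ.rangeRestrict x))) = s (φ.rangeRestrict x)
    rw [hs'])
  have hip' : ∀ x, linOf p (linOf i x) = x := fun x =>
    congrArg (fun f : P ⟶ P => linOf f x) hip
  have hpi' : ∀ x, linOf i (linOf p x) = s (φ.rangeRestrict x) := fun x =>
    congrArg (fun f : X ⟶ X => linOf f x) hpi
  -- `P` is a retract of the projective right ideal `range φ`.
  have hproj : Module.Projective Rᵐᵒᵖ P.obj.obj :=
    Module.Projective.of_split (φ.rangeRestrict ∘ₗ linOf i) (linOf p ∘ₗ s) (by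
      ext x
      change linOf p (s (φ.rangeRestrict (linOf i x))) = x
      rw [← hpi', hip', hip'])
  have hsub : Subsingleton P.obj.obj := by
    by_contra hne
    have hnt : Nontrivial P.obj.obj := not_subsingleton_iff_nontrivial.1 hne
    have : Projective P.obj.obj := ModuleCat.projective_of_categoryTheory_projective P.obj.obj
    have h0 := ModuleCat.projectiveDimension_eq_zero_of_projective P.obj.obj
    rw [hdim P.obj P.property hnt] at h0
    exact one_ne_zero h0
  ext x
  have h0 : s (φ.rangeRestrict x) = 0 := by
    rw [← hpi', Subsingleton.elim (linOf p x) 0, map_zero]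
  have h1 := hs' (φ.rangeRestrict x)
  rw [h0, map_zero] at h1
  exact congrArg Subtype.val h1.symm

/-- The submodule underlying a subobject. -/
noncomputable def submoduleOf {R : Type u} [Ring R] {E : ObjectProperty (FPMod R)}
    {X : E.FullSubcategory} (A : Subobject X) : Submodule Rᵐᵒᵖ X.obj.obj :=
  LinearMap.range (linOf A.arrow)

theorem submoduleOf_mono {R : Type u} [Ring R] {E : ObjectProperty (FPMod R)}
    {X : E.FullSubcategory} : Monotone (submoduleOf (X := X)) := by
  rintro A B h _ ⟨x, rfl⟩
  exact ⟨linOf (Subobject.ofLE A B h) x,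
    congrArg (fun f : (A : E.FullSubcategory) ⟶ X => linOf f x) (Subobject.ofLE_arrow h)⟩

/-- Exactness makes `B.arrow` injective, so `A.arrow` factors linearly through it, and `E` is full.
Strict chains of subobjects thus give strict chains of submodules. -/
theorem IsWellPlaced.le_of_submoduleOf_le {R : Type u} [Ring R] {E : ObjectProperty (FPMod R)}
    (hE : IsWellPlaced E) {X : E.FullSubcategory} {A B : Subobject X}
    (h : submoduleOf A ≤ submoduleOf B) : A ≤ B := by
  let e := LinearEquiv.ofInjective (linOf B.arrow) (hE.injective_of_mono B.arrow)
  let g := e.symm.toLinearMap ∘ₗ (linOf A.arrow).codRestrict (LinearMap.range (linOf B.arrow))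
    fun x => h ⟨x, rfl⟩
  refine Subobject.le_of_comm (homOf g) ?_
  ext x
  change (e (e.symm _) : X.obj.obj) = _
  rw [LinearEquiv.apply_symm_apply]
  rfl

/-- Forms on the image pull back to forms on the object `A` of `E`, which is bound. -/
theorem IsWellPlaced.isBoundModule_submoduleOf {R : Type u} [Ring R]
    (hR : IsHereditaryRing R) {E : ObjectProperty (FPMod R)} (hE : IsWellPlaced E)
    (hdim : ∀ M : FPMod R, E M → Nontrivial M.obj → projectiveDimension M.obj = 1)
    {X : E.FullSubcategory} (A : Subobject X) : IsBoundModule R (submoduleOf A) := by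
  intro φ
  have h := hE.isBoundModule hR hdim (A : E.FullSubcategory)
    (φ ∘ₗ (linOf A.arrow).rangeRestrict)
  ext ⟨_, x, rfl⟩
  exact LinearMap.congr_fun h x

theorem mainTheorem8 (R : Type u) [Ring R] (hR : IsHereditaryRing R)
    (E : ObjectProperty (FPMod R)) (hE : IsWellPlaced E)
    (hdim : ∀ M : FPMod R, E M → Nontrivial M.obj → projectiveDimension M.obj = 1) :
    IsFiniteLengthCategory E.FullSubcategory := by
  refine ⟨hE.isAbelian, ?_⟩
  let := hE.isAbelian.abelian
  have hfp : ∀ X : E.FullSubcategory, Module.FinitePresentation Rᵐᵒᵖ X.obj.obj :=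
    fun X => X.obj.property
  refine hasFiniteLength_of_noetherian_of_artinian (fun X => ?_) (fun X => ?_)
  · refine (isNoetherianObject_iff_not_strictMono X).2 fun f hf => ?_
    have hmono : Monotone fun i => submoduleOf (f i) := submoduleOf_mono.comp hf.monotone
    obtain ⟨i, hi⟩ := exists_eq_iSup_of_fg hmono
      (iSup_fg_of_isBoundModule hR.right X.obj.obj _ hmono
        fun i => hE.isBoundModule_submoduleOf hR hdim (f i))
    exact (hf (Nat.lt_succ_self i)).not_ge (hE.le_of_submoduleOf_le
      (hi ▸ le_iSup (fun i => submoduleOf (f i)) (i + 1)))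
  · refine (isArtinianObject_iff_not_strictAnti X).2 fun f hf => ?_
    obtain ⟨i, hi⟩ := exists_le_succ_of_isBoundModule hR X.obj.obj
      (fun i => submoduleOf (f i))
      (fun i j hij => submoduleOf_mono (hf.antitone hij))
      (fun i => by
        have h : Module.Finite Rᵐᵒᵖ (f i : E.FullSubcategory).obj.obj :=
          have := hfp (f i); inferInstance
        have h' := h.fg_top.map (linOf (f i).arrow)
        rwa [Submodule.map_top] at h')
      (fun i => hE.isBoundModule_submoduleOf hR hdim (f i))
    exact (hf (Nat.lt_succ_self i)).not_ge (hE.le_of_submoduleOf_le hi)
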